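/- For $n\ge 0$ let $h_n(x)=(\sqrt{\pi}\,2^n n!)^{-1/2}H_n(x)e^{-x^2/2}$ be the Hermite functions on $\mathbb{R}$, where $H_n$ is the $n$-th (physicists') Hermite polynomial. Let $\mathcal{S}$ be the space of real-valued Schwartz functions on $\mathbb{R}$ and $\mathcal{S}'$ its dual, the space of tempered distributions. For $q\in\mathbb{R}$ let $\mathcal{S}_q\subset\mathcal{S}'$ be the Hermite--Sobolev space, that is, the completion of $\mathcal{S}$ in the norm $$\|\phi\|_q^2=\sum_{n=0}^\infty (2n+1)^{2q}\Big(\int_{\mathbb{R}}\phi(x)h_n(x)\,dx\Big)^2,$$ where the class of a $\|\cdot\|_q$-Cauchy sequence of Schwartz functions is identified with its limit in $\mathcal{S}'$. Then the tempered distribution $\phi\mapsto\int_{\mathbb{R}}x\,\phi(x)\,dx$ given by the function $x\mapsto x$ belongs to $\mathcal{S}_{-p}$ for every real $p>\frac34$, and the tempered distribution $\phi\mapsto\int_{\mathbb{R}}x^3\,\phi(x)\,dx$ given by the function $x\mapsto x^3$ belongs to $\mathcal{S}_{-p}$ for every real $p>\frac74$. -/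

import Mathlib

open MeasureTheory Filter Topology
open scoped SchwartzMap ENNReal Nat

/-- The `n`-th Hermite function on the real line,
`h_n(x) = (√π · 2ⁿ · n!)^(-1/2) · H_n(x) · exp (-x²/2)`, where `H_n` is the physicists' Hermite
polynomial. Mathlib's `Polynomial.hermite n` is the probabilists' polynomial `He_n`, and
`H_n(x) = 2^(n/2) · He_n(√2 · x)`, so that the powers of `2` cancel. -/
noncomputable def hermiteFun (n : ℕ) (x : ℝ) : ℝ :=
  (Real.sqrt (Real.sqrt Real.pi * (n ! : ℝ)))⁻¹ *
    Polynomial.aeval (Real.sqrt 2 * x) (Polynomial.hermite n) * Real.exp (-x ^ 2 / 2)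

/-- The `L²` inner product `⟨g, h_n⟩` of a real Schwartz function with a Hermite function. -/
noncomputable def hermiteCoeff (g : 𝓢(ℝ, ℝ)) (n : ℕ) : ℝ :=
  ∫ x : ℝ, g x * hermiteFun n x

/-- The square of the Hermite-Sobolev norm of index `p` of a real Schwartz function,
`‖g‖_p² = ∑ₙ (2n+1)^(2p) ⟨g, h_n⟩²`. -/
noncomputable def hermiteNormSq (p : ℝ) (g : 𝓢(ℝ, ℝ)) : ℝ≥0∞ :=
  ∑' n : ℕ, ENNReal.ofReal ((2 * (n : ℝ) + 1) ^ (2 * p) * hermiteCoeff g n ^ 2)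

/-- Real tempered distributions on the real line: the continuous dual of the space of real-valued
Schwartz functions. -/
abbrev RealTempered : Type := 𝓢(ℝ, ℝ) →L[ℝ] ℝ

/-- The tempered distribution `ψ ↦ ∫ ψ(x) f(x) dx` given by a function `f` of temperate growth
(smooth, with all derivatives polynomially bounded). -/
noncomputable def RealTempered.ofFun (f : ℝ → ℝ) (hf : f.HasTemperateGrowth) : RealTempered :=
  (SchwartzMap.integralCLM ℝ (volume : Measure ℝ)) ∘L
    (SchwartzMap.bilinLeftCLM (ContinuousLinearMap.mul ℝ ℝ) hf)

theorem RealTempered.ofFun_apply (f : ℝ → ℝ) (hf : f.HasTemperateGrowth) (ψ : 𝓢(ℝ, ℝ)) :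
    RealTempered.ofFun f hf ψ = ∫ x : ℝ, ψ x * f x := rfl

theorem hasTemperateGrowth_fun_id : (fun x : ℝ => x).HasTemperateGrowth := by
  fun_prop

theorem hasTemperateGrowth_pow (k : ℕ) : (fun x : ℝ => x ^ k).HasTemperateGrowth := by
  fun_prop

/-- The Hermite-Sobolev space `S_p`: the completion of the space of real Schwartz functions in the
norm `‖·‖_p`, realised inside the tempered distributions. A point of the completion is a class of
`‖·‖_p`-Cauchy sequences of Schwartz functions, and it is identified with the limit of such a
sequence in the sense of tempered distributions. -/
def HermiteSobolev (p : ℝ) : Set RealTempered :=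
  {T | ∃ g : ℕ → 𝓢(ℝ, ℝ),
    Tendsto (fun m : ℕ × ℕ => hermiteNormSq p (g m.1 - g m.2)) atTop (𝓝 0) ∧
    ∀ ψ : 𝓢(ℝ, ℝ),
      Tendsto (fun k : ℕ => RealTempered.ofFun (g k) (g k).hasTemperateGrowth ψ) atTop (𝓝 (T ψ))}

/-! The monomial x^j is approximated by x^j exp(-x²/(k+1)). Against h_n this gives, up to the factor
(√π n!)^(-1/2), the moment of X^j · He_n(√2 x) for the weight exp(-b x²), with b = 1/(k+1) + 1/2
decreasing to 1/2. For j = 0, integration by parts multiplies the moment by (n+1)(1/b - 1) when n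
grows by 2, and |1/b - 1| ≤ 1 for b ≥ 1/2; each factor X is then absorbed by the three-term
recurrence. Hence the squared coefficients are O((n+1)^(j - 1/2)) uniformly in k
(`exists_sq_hermiteCoeff_gaussianCutoffPow_le`). This is summable against (2n+1)^(-2p) as soon as p
> j/2 + 1/4, and dominated convergence makes the sequence Cauchy. -/

open Polynomial in
/-- The polynomial `He_n(√2 x)`, that is, `2^(-n/2) H_n(x)`. -/
noncomputable def scaledHermite (n : ℕ) : ℝ[X] :=
  ((hermite n).map (algebraMap ℤ ℝ)).comp (C (Real.sqrt 2) * X)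

/-- The integral of a polynomial against the Gaussian `exp (-b x²)`. -/
noncomputable def gaussianMoment (b : ℝ) (P : Polynomial ℝ) : ℝ :=
  ∫ x : ℝ, P.eval x * Real.exp (-b * x ^ 2)

/-! ### Polynomials times Gaussians as Schwartz functions, and their moments. -/

theorem exists_abs_eval_mul_gaussian_le {b : ℝ} (hb : 0 < b) (P : Polynomial ℝ) :
    ∃ C : ℝ, ∀ x : ℝ, |P.eval x * Real.exp (-b * x ^ 2)| ≤ C := by
  induction P using Polynomial.induction_on' with
  | add P Q hP hQ =>
    obtain ⟨C, hC⟩ := hP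
    obtain ⟨D, hD⟩ := hQ
    refine ⟨C + D, fun x => ?_⟩
    rw [Polynomial.eval_add, add_mul]
    exact (abs_add_le _ _).trans (add_le_add (hC x) (hD x))
  | monomial n a =>
    refine ⟨|a| * (1 + n ! / b ^ n), fun x => ?_⟩
    -- Passing to even powers lets the exponential series in b x² bound odd n too.
    have h1 : |x| ^ n ≤ 1 + (x ^ 2) ^ n := by
      rw [← sq_abs, ← pow_mul, mul_comm 2 n, pow_mul]
      nlinarith [sq_nonneg (|x| ^ n - 1), sq_nonneg (|x| ^ n)]
    have h2 : (x ^ 2) ^ n ≤ n ! / b ^ n * Real.exp (b * x ^ 2) := by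
      have h := Real.pow_div_factorial_le_exp (b * x ^ 2) (by positivity) n
      rw [div_le_iff₀ (by positivity), mul_pow] at h
      rw [div_mul_eq_mul_div, le_div_iff₀ (by positivity)]
      linarith
    have h3 : 1 ≤ Real.exp (b * x ^ 2) := Real.one_le_exp (by positivity)
    rw [Polynomial.eval_monomial, abs_mul, abs_mul, abs_pow, Real.abs_exp, mul_assoc]
    refine mul_le_mul_of_nonneg_left ?_ (abs_nonneg a)
    rw [neg_mul, Real.exp_neg, ← div_eq_mul_inv, div_le_iff₀ (Real.exp_pos _)]
    linarith

open Polynomial in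
theorem hasDerivAt_eval_mul_gaussian (b : ℝ) (P : ℝ[X]) (x : ℝ) :
    HasDerivAt (fun x : ℝ => P.eval x * Real.exp (-b * x ^ 2))
      ((derivative P - C (2 * b) * X * P).eval x * Real.exp (-b * x ^ 2)) x := by
  have h : HasDerivAt (fun x : ℝ => -b * x ^ 2) (-b * (2 * x)) x := by
    simpa using (hasDerivAt_pow 2 x).const_mul (-b)
  convert! (P.hasDerivAt x).mul h.exp using 1
  simp only [eval_sub, eval_mul, eval_C, eval_X]
  ring

theorem exists_iteratedDeriv_eval_mul_gaussian (b : ℝ) (P : Polynomial ℝ) (n : ℕ) :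
    ∃ Q : Polynomial ℝ, iteratedDeriv n (fun x : ℝ => P.eval x * Real.exp (-b * x ^ 2)) =
      fun x => Q.eval x * Real.exp (-b * x ^ 2) := by
  induction n with
  | zero => exact ⟨P, iteratedDeriv_zero⟩
  | succ n ih =>
    obtain ⟨Q, hQ⟩ := ih
    exact ⟨_, by rw [iteratedDeriv_succ, hQ]; exact deriv_eq (hasDerivAt_eval_mul_gaussian b Q)⟩

/-- The Schwartz function `P(x) exp (-b x²)`. -/
noncomputable def polynomialGaussian {b : ℝ} (hb : 0 < b) (P : Polynomial ℝ) : 𝓢(ℝ, ℝ) where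
  toFun x := P.eval x * Real.exp (-b * x ^ 2)
  smooth' := by
    have h := P.contDiff_aeval (𝕜 := ℝ) (n := (⊤ : ℕ∞))
    simp only [Polynomial.coe_aeval_eq_eval] at h
    fun_prop
  decay' k n := by
    obtain ⟨Q, hQ⟩ := exists_iteratedDeriv_eval_mul_gaussian b P n
    obtain ⟨C, hC⟩ := exists_abs_eval_mul_gaussian_le hb (Polynomial.X ^ k * Q)
    refine ⟨C, fun x => ?_⟩
    rw [norm_iteratedFDeriv_eq_norm_iteratedDeriv, hQ, ← norm_pow, ← norm_mul, Real.norm_eq_abs]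
    simpa [mul_assoc] using hC x

theorem polynomialGaussian_apply {b : ℝ} (hb : 0 < b) (P : Polynomial ℝ) (x : ℝ) :
    polynomialGaussian hb P x = P.eval x * Real.exp (-b * x ^ 2) := rfl

theorem integrable_eval_mul_gaussian {b : ℝ} (hb : 0 < b) (P : Polynomial ℝ) :
    Integrable (fun x : ℝ => P.eval x * Real.exp (-b * x ^ 2)) :=
  (polynomialGaussian hb P).integrable

theorem gaussianMoment_add {b : ℝ} (hb : 0 < b) (P Q : Polynomial ℝ) :
    gaussianMoment b (P + Q) = gaussianMoment b P + gaussianMoment b Q := by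
  simp only [gaussianMoment, Polynomial.eval_add, add_mul]
  exact integral_add (integrable_eval_mul_gaussian hb P) (integrable_eval_mul_gaussian hb Q)

theorem gaussianMoment_C_mul (b a : ℝ) (P : Polynomial ℝ) :
    gaussianMoment b (Polynomial.C a * P) = a * gaussianMoment b P := by
  simp only [gaussianMoment, Polynomial.eval_mul, Polynomial.eval_C, mul_assoc]
  exact integral_const_mul _ _

open Polynomial in
/-- Integration by parts against a Gaussian. -/
theorem gaussianMoment_derivative {b : ℝ} (hb : 0 < b) (P : ℝ[X]) :
    gaussianMoment b (derivative P) = 2 * b * gaussianMoment b (X * P) := by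
  have h := integral_eq_zero_of_hasDerivAt_of_integrable (hasDerivAt_eval_mul_gaussian b P)
    (integrable_eval_mul_gaussian hb _) (integrable_eval_mul_gaussian hb P)
  change gaussianMoment b _ = 0 at h
  rw [show derivative P - C (2 * b) * X * P = derivative P + C (-(2 * b)) * (X * P) by
    rw [C_neg]; ring, gaussianMoment_add hb, gaussianMoment_C_mul] at h
  linarith

/-! ### Hermite recurrences and moments. -/

open Polynomial in
theorem derivative_hermite_succ (n : ℕ) :
    derivative (hermite (n + 1)) = ((n : ℤ[X]) + 1) * hermite n := by
  induction n with
  | zero => simp [hermite_zero]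
  | succ n ih =>
    have h := hermite_succ n
    rw [hermite_succ (n + 1), derivative_sub, derivative_mul, derivative_X, ih]
    simp only [derivative_mul, derivative_add, derivative_natCast, derivative_one]
    rw [h]
    push_cast
    ring

open Polynomial in
theorem scaledHermite_zero : scaledHermite 0 = 1 := by simp [scaledHermite]

open Polynomial in
theorem scaledHermite_one : scaledHermite 1 = C (Real.sqrt 2) * X := by simp [scaledHermite]

open Polynomial in
theorem scaledHermite_add_two (n : ℕ) :
    scaledHermite (n + 2) =
      C (Real.sqrt 2) * (X * scaledHermite (n + 1)) + C (-((n : ℝ) + 1)) * scaledHermite n := by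
  simp only [scaledHermite]
  rw [hermite_succ (n + 1), derivative_hermite_succ]
  simp only [Polynomial.map_sub, Polynomial.map_mul, Polynomial.map_add, Polynomial.map_natCast,
    Polynomial.map_one, map_X, sub_comp, mul_comp, add_comp, X_comp, natCast_comp, one_comp, C_neg,
    C_add, map_natCast, C_1]
  ring

open Polynomial in
theorem derivative_scaledHermite_succ (n : ℕ) :
    derivative (scaledHermite (n + 1)) =
      C (Real.sqrt 2 * ((n : ℝ) + 1)) * scaledHermite n := by
  simp only [scaledHermite]
  rw [derivative_comp, derivative_map, derivative_hermite_succ]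
  simp [mul_assoc]

theorem gaussianMoment_scaledHermite_one {b : ℝ} (hb : 0 < b) :
    gaussianMoment b (scaledHermite 1) = 0 := by
  have h := gaussianMoment_derivative hb 1
  rw [mul_one, Polynomial.derivative_one, ← zero_mul (1 : Polynomial ℝ), ← Polynomial.C_0,
    gaussianMoment_C_mul, zero_mul] at h
  rw [scaledHermite_one, gaussianMoment_C_mul]
  simp [hb.ne'] at h
  simp [h]

theorem gaussianMoment_scaledHermite_add_two {b : ℝ} (hb : 0 < b) (n : ℕ) :
    gaussianMoment b (scaledHermite (n + 2)) =
      ((n : ℝ) + 1) * (1 / b - 1) * gaussianMoment b (scaledHermite n) := by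
  have h := gaussianMoment_derivative hb (scaledHermite (n + 1))
  rw [derivative_scaledHermite_succ, gaussianMoment_C_mul] at h
  rw [scaledHermite_add_two, gaussianMoment_add hb, gaussianMoment_C_mul, gaussianMoment_C_mul]
  have h2 : Real.sqrt 2 * Real.sqrt 2 = 2 := Real.mul_self_sqrt (by norm_num)
  have h3 : gaussianMoment b (Polynomial.X * scaledHermite (n + 1)) =
      Real.sqrt 2 * ((n : ℝ) + 1) * gaussianMoment b (scaledHermite n) / (2 * b) := by
    rw [h]; field_simp
  rw [h3]
  field_simp
  linear_combination gaussianMoment b (scaledHermite n) * h2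

open Polynomial in
theorem gaussianMoment_X_pow_succ_mul_scaledHermite_succ {b : ℝ} (hb : 0 < b) (j n : ℕ) :
    Real.sqrt 2 * gaussianMoment b (X ^ (j + 1) * scaledHermite (n + 1)) =
      gaussianMoment b (X ^ j * scaledHermite (n + 2)) +
        ((n : ℝ) + 1) * gaussianMoment b (X ^ j * scaledHermite n) := by
  rw [← gaussianMoment_C_mul, ← gaussianMoment_C_mul, ← gaussianMoment_add hb,
    scaledHermite_add_two, C_neg]
  congr 1
  ring

/-- The constant is the n = 0 value π/b at its worst, b = 1/2. The factor √(n+1) is the Wallis-type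
gain that yields the exponent -1/2. -/
theorem sq_gaussianMoment_scaledHermite_le {b : ℝ} (hb : 1 / 2 ≤ b) (n : ℕ) :
    Real.sqrt ((n : ℝ) + 1) * gaussianMoment b (scaledHermite n) ^ 2 ≤
      2 * Real.pi * n ! := by
  have hb0 : 0 < b := by linarith
  induction n using Nat.twoStepInduction with
  | zero =>
    have h : gaussianMoment b (scaledHermite 0) = Real.sqrt (Real.pi / b) := by
      simp [gaussianMoment, scaledHermite_zero, ← integral_gaussian]
    rw [h, Real.sq_sqrt (by positivity)]
    simp only [Nat.cast_zero, zero_add, Real.sqrt_one, one_mul, Nat.factorial_zero, Nat.cast_one,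
      mul_one]
    rw [div_le_iff₀ hb0]
    nlinarith [Real.pi_pos]
  | one =>
    rw [gaussianMoment_scaledHermite_one hb0]
    simpa using Real.pi_pos.le
  | more n ih _ =>
    rw [gaussianMoment_scaledHermite_add_two hb0]
    have hr : (1 / b - 1) ^ 2 ≤ 1 := by
      have h1 : 1 / b ≤ 2 := by rw [div_le_iff₀ hb0]; linarith
      have h2 : 0 < 1 / b := by positivity
      nlinarith
    -- Since (n+1)(n+3) ≤ (n+2)², the weight √(n+1) survives a step of 2.
    have hs : Real.sqrt ((n : ℝ) + 1) * Real.sqrt ((n : ℝ) + 3) ≤ n + 2 := by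
      rw [← Real.sqrt_mul (by positivity), Real.sqrt_le_left (by positivity)]
      nlinarith
    have hs2 : Real.sqrt ((n : ℝ) + 1) * Real.sqrt ((n : ℝ) + 1) = n + 1 :=
      Real.mul_self_sqrt (by positivity)
    have hfac : ((n + 2)! : ℝ) = (n + 2) * ((n + 1) * n !) := by
      simp only [Nat.factorial_succ]; push_cast; ring
    have hcast : ((n + 2 : ℕ) : ℝ) + 1 = n + 3 := by push_cast; ring
    rw [hcast, hfac]
    set J := gaussianMoment b (scaledHermite n)
    set s := Real.sqrt ((n : ℝ) + 1)
    set u := Real.sqrt ((n : ℝ) + 3)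
    have hn : (0 : ℝ) < n + 1 := by positivity
    have hu : 0 ≤ u := Real.sqrt_nonneg _
    have hs0 : 0 ≤ s := Real.sqrt_nonneg _
    calc u * ((n + 1) * (1 / b - 1) * J) ^ 2
        = (1 / b - 1) ^ 2 * (u * (n + 1) ^ 2 * J ^ 2) := by ring
      _ ≤ 1 * (u * (n + 1) ^ 2 * J ^ 2) := by gcongr
      _ = (n + 1) * (s * u) * (s * J ^ 2) := by
        linear_combination (-(u * (n + 1) * J ^ 2)) * hs2
      _ ≤ (n + 1) * (n + 2) * (2 * Real.pi * n !) := by gcongr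
      _ = _ := by ring

-- Induction on j: the recurrence trades a factor X at index n+1 for indices n and n+2, which costs
-- one power of n+1 in the square. The constant must not depend on b.
open Polynomial in
theorem exists_sq_gaussianMoment_X_pow_mul_scaledHermite_le (j : ℕ) :
    ∃ K : ℝ, 0 ≤ K ∧ ∀ b : ℝ, 1 / 2 ≤ b → ∀ n : ℕ,
      Real.sqrt ((n : ℝ) + 1) * gaussianMoment b (X ^ j * scaledHermite n) ^ 2 ≤
        K * n ! * ((n : ℝ) + 1) ^ j := by
  induction j with
  | zero =>
    refine ⟨2 * Real.pi, by positivity, fun b hb n => ?_⟩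
    simpa using sq_gaussianMoment_scaledHermite_le hb n
  | succ j ih =>
    obtain ⟨K, hK, h⟩ := ih
    -- 2^j comes from n+3 ≤ 2(n+2), and the summand 2 from √(n+2) ≤ 2√(n+1).
    refine ⟨K * (2 ^ j + 2), by positivity, fun b hb n => ?_⟩
    have hb0 : 0 < b := by linarith
    have h2 : Real.sqrt 2 * Real.sqrt 2 = 2 := Real.mul_self_sqrt (by norm_num)
    cases n with
    | zero =>
      have h1 := h b hb 1
      have hX : gaussianMoment b (X ^ j * scaledHermite 1) =
          Real.sqrt 2 * gaussianMoment b (X ^ (j + 1) * scaledHermite 0) := by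
        rw [← gaussianMoment_C_mul, scaledHermite_one, scaledHermite_zero]
        congr 1
        ring
      rw [hX] at h1
      norm_num at h1 ⊢
      rw [mul_pow, Real.sq_sqrt (by norm_num)] at h1
      have h3 : 1 ≤ Real.sqrt 2 := Real.one_le_sqrt.2 (by norm_num)
      set J := gaussianMoment b (X ^ (j + 1) * scaledHermite 0)
      nlinarith [sq_nonneg J, mul_nonneg (sub_nonneg.2 h3) (sq_nonneg J)]
    | succ n =>
      have hrec := gaussianMoment_X_pow_succ_mul_scaledHermite_succ hb0 j n
      have ha := h b hb n
      have hc := h b hb (n + 2)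
      have hf1 : ((n + 1)! : ℝ) = (n + 1) * n ! := by
        rw [Nat.factorial_succ]; push_cast; ring
      have hf2 : ((n + 2)! : ℝ) = (n + 2) * ((n + 1) * n !) := by
        simp only [Nat.factorial_succ]; push_cast; ring
      have hc2 : ((n + 2 : ℕ) : ℝ) + 1 = n + 3 := by push_cast; ring
      have hc1 : ((n + 1 : ℕ) : ℝ) + 1 = n + 2 := by push_cast; ring
      rw [hc2, hf2] at hc
      rw [hc1, hf1]
      set J := gaussianMoment b (X ^ (j + 1) * scaledHermite (n + 1))
      set A := gaussianMoment b (X ^ j * scaledHermite n)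
      set B := gaussianMoment b (X ^ j * scaledHermite (n + 2))
      -- From 2J² = (B + (n+1)A)² ≤ 2B² + 2(n+1)²A².
      have hJ : J ^ 2 ≤ B ^ 2 + ((n : ℝ) + 1) ^ 2 * A ^ 2 := by
        nlinarith [sq_nonneg (B - ((n : ℝ) + 1) * A), congrArg (· ^ 2) hrec]
      have hs1 : Real.sqrt ((n : ℝ) + 2) ≤ Real.sqrt ((n : ℝ) + 3) :=
        Real.sqrt_le_sqrt (by linarith)
      have hs2 : Real.sqrt ((n : ℝ) + 2) ≤ 2 * Real.sqrt ((n : ℝ) + 1) := by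
        rw [Real.sqrt_le_left (by positivity), mul_pow, Real.sq_sqrt (by positivity)]
        linarith
      have hp1 : ((n : ℝ) + 3) ^ j ≤ 2 ^ j * ((n : ℝ) + 2) ^ j := by
        rw [← mul_pow]
        gcongr
        linarith
      have hp2 : ((n : ℝ) + 1) ^ (j + 1) ≤ ((n : ℝ) + 2) ^ (j + 1) := by
        gcongr
        linarith
      calc Real.sqrt ((n : ℝ) + 2) * J ^ 2
          ≤ Real.sqrt ((n : ℝ) + 2) * (B ^ 2 + ((n : ℝ) + 1) ^ 2 * A ^ 2) := by gcongr
        _ = Real.sqrt ((n : ℝ) + 2) * B ^ 2 +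
            Real.sqrt ((n : ℝ) + 2) * (((n : ℝ) + 1) ^ 2 * A ^ 2) := by ring
        _ ≤ Real.sqrt ((n : ℝ) + 3) * B ^ 2 +
            2 * Real.sqrt ((n : ℝ) + 1) * (((n : ℝ) + 1) ^ 2 * A ^ 2) := by gcongr
        _ = Real.sqrt ((n : ℝ) + 3) * B ^ 2 +
            2 * ((n : ℝ) + 1) ^ 2 * (Real.sqrt ((n : ℝ) + 1) * A ^ 2) := by ring
        _ ≤ K * ((n + 2) * ((n + 1) * n !)) * ((n : ℝ) + 3) ^ j +
            2 * ((n : ℝ) + 1) ^ 2 * (K * n ! * ((n : ℝ) + 1) ^ j) := by gcongr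
        _ = K * ((n + 1) * n !) * ((n + 2) * ((n : ℝ) + 3) ^ j + 2 * ((n : ℝ) + 1) ^ (j + 1)) := by
          ring
        _ ≤ K * ((n + 1) * n !) *
            ((n + 2) * (2 ^ j * ((n : ℝ) + 2) ^ j) + 2 * ((n : ℝ) + 2) ^ (j + 1)) := by gcongr
        _ = _ := by ring

/-- The limit c is also a lower bound, so the integrand at c dominates. -/
theorem tendsto_gaussianMoment {b : ℕ → ℝ} {c : ℝ} (hc : 0 < c) (hb : ∀ k, c ≤ b k)
    (hlim : Tendsto b atTop (𝓝 c)) (P : Polynomial ℝ) :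
    Tendsto (fun k => gaussianMoment (b k) P) atTop (𝓝 (gaussianMoment c P)) := by
  refine tendsto_integral_of_dominated_convergence
    (fun x => ‖P.eval x * Real.exp (-c * x ^ 2)‖)
    (fun k => (integrable_eval_mul_gaussian (hc.trans_le (hb k)) P).aestronglyMeasurable)
    (integrable_eval_mul_gaussian hc P).norm (fun k => ae_of_all _ fun x => ?_)
    (ae_of_all _ fun x => ?_)
  · rw [norm_mul, norm_mul, Real.norm_eq_abs (Real.exp _), Real.norm_eq_abs (Real.exp _),
      Real.abs_exp, Real.abs_exp]
    gcongr
    exact hb k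
  · exact tendsto_const_nhds.mul
      ((Real.continuous_exp.tendsto _).comp (hlim.neg.mul tendsto_const_nhds))

/-! ### Hermite coefficients of the Gaussian cutoffs. -/

theorem hermiteCoeff_polynomialGaussian {t : ℝ} (ht : 0 < t) (P : Polynomial ℝ) (n : ℕ) :
    hermiteCoeff (polynomialGaussian ht P) n =
      (Real.sqrt (Real.sqrt Real.pi * (n ! : ℝ)))⁻¹ *
        gaussianMoment (t + 1 / 2) (P * scaledHermite n) := by
  rw [hermiteCoeff, gaussianMoment, ← integral_const_mul]
  congr 1
  ext x
  have he : Real.exp (-(t + 1 / 2) * x ^ 2) = Real.exp (-t * x ^ 2) * Real.exp (-x ^ 2 / 2) := by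
    rw [← Real.exp_add]
    ring_nf
  have hQ : (scaledHermite n).eval x =
      Polynomial.aeval (Real.sqrt 2 * x) (Polynomial.hermite n) := by
    rw [scaledHermite, Polynomial.eval_comp, Polynomial.eval_map_algebraMap]
    simp
  rw [polynomialGaussian_apply, hermiteFun, Polynomial.eval_mul, hQ, he]
  ring

theorem hermiteCoeff_sub (f g : 𝓢(ℝ, ℝ)) (n : ℕ) :
    hermiteCoeff (f - g) n = hermiteCoeff f n - hermiteCoeff g n := by
  have hh : ∀ x, hermiteFun n x = polynomialGaussian (b := 1 / 2) (by norm_num)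
      (Polynomial.C (Real.sqrt (Real.sqrt Real.pi * (n ! : ℝ)))⁻¹ * scaledHermite n) x := by
    intro x
    simp only [polynomialGaussian_apply, hermiteFun, scaledHermite, Polynomial.eval_mul,
      Polynomial.eval_C, Polynomial.eval_comp, Polynomial.eval_X, Polynomial.eval_map_algebraMap]
    ring_nf
  have hi : ∀ g : 𝓢(ℝ, ℝ), Integrable (fun x => g x * hermiteFun n x) := by
    intro g
    simp only [hh]
    exact (SchwartzMap.bilinLeftCLM (ContinuousLinearMap.mul ℝ ℝ)
      (polynomialGaussian _ _).hasTemperateGrowth g).integrable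
  simp only [hermiteCoeff, _root_.sub_apply, sub_mul]
  exact integral_sub (hi f) (hi g)

/-- The functions `x ^ j * exp (-x² / (k + 1))`, which approximate `x ^ j`. -/
noncomputable def gaussianCutoffPow (j k : ℕ) : 𝓢(ℝ, ℝ) :=
  polynomialGaussian (b := 1 / ((k : ℝ) + 1)) (by positivity) (Polynomial.X ^ j)

theorem exists_tendsto_hermiteCoeff_gaussianCutoffPow (j n : ℕ) :
    ∃ a : ℝ, Tendsto (fun k => hermiteCoeff (gaussianCutoffPow j k) n) atTop (𝓝 a) := by
  simp only [gaussianCutoffPow, hermiteCoeff_polynomialGaussian]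
  refine ⟨_, Tendsto.const_mul _ (tendsto_gaussianMoment (c := 1 / 2) (by norm_num)
    (fun k => ?_) ?_ _)⟩
  · have : (0 : ℝ) < 1 / ((k : ℝ) + 1) := by positivity
    linarith
  · simpa only [zero_add] using
      (tendsto_one_div_add_atTop_nhds_zero_nat (𝕜 := ℝ)).add_const (1 / 2)

theorem exists_sq_hermiteCoeff_gaussianCutoffPow_le (j : ℕ) :
    ∃ K : ℝ, 0 ≤ K ∧ ∀ k n : ℕ, hermiteCoeff (gaussianCutoffPow j k) n ^ 2 ≤
      K * ((n : ℝ) + 1) ^ ((j : ℝ) - 1 / 2) := by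
  obtain ⟨K, hK, h⟩ := exists_sq_gaussianMoment_X_pow_mul_scaledHermite_le j
  refine ⟨K / Real.sqrt Real.pi, by positivity, fun k n => ?_⟩
  have hk : (0 : ℝ) < 1 / ((k : ℝ) + 1) := by positivity
  have hn := h (1 / ((k : ℝ) + 1) + 1 / 2) (by linarith) n
  rw [gaussianCutoffPow, hermiteCoeff_polynomialGaussian, mul_pow, inv_pow,
    Real.sq_sqrt (by positivity), Real.rpow_sub (by positivity), Real.rpow_natCast,
    ← Real.sqrt_eq_rpow]
  have hs : 0 < Real.sqrt ((n : ℝ) + 1) := Real.sqrt_pos.2 (by positivity)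
  have hf : (0 : ℝ) < n ! := by positivity
  have hpi : 0 < Real.sqrt Real.pi := Real.sqrt_pos.2 Real.pi_pos
  rw [inv_mul_le_iff₀ (by positivity)]
  have hr : Real.sqrt Real.pi * n ! * (K / Real.sqrt Real.pi *
      (((n : ℝ) + 1) ^ j / Real.sqrt ((n : ℝ) + 1))) =
      K * n ! * ((n : ℝ) + 1) ^ j / Real.sqrt ((n : ℝ) + 1) := by
    field_simp
  rw [hr, le_div_iff₀ hs]
  linarith

theorem tendsto_hermiteNormSq_gaussianCutoffPow_sub (j : ℕ) {p : ℝ} (hp : (j : ℝ) / 2 + 1 / 4 < p) :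
    Tendsto (fun m : ℕ × ℕ =>
      hermiteNormSq (-p) (gaussianCutoffPow j m.1 - gaussianCutoffPow j m.2)) atTop (𝓝 0) := by
  obtain ⟨K, hK, hbound⟩ := exists_sq_hermiteCoeff_gaussianCutoffPow_le j
  have hp0 : 0 < p := lt_of_le_of_lt (by positivity) hp
  set F : ℕ × ℕ → ℕ → ℝ := fun m n => (2 * (n : ℝ) + 1) ^ (2 * -p) *
    hermiteCoeff (gaussianCutoffPow j m.1 - gaussianCutoffPow j m.2) n ^ 2 with hF
  -- The 4 comes from (u - v)² ≤ 2u² + 2v².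
  set B : ℕ → ℝ := fun n => 4 * K * ((n : ℝ) + 1) ^ ((j : ℝ) - 1 / 2 - 2 * p) with hB
  have hF0 : ∀ m n, 0 ≤ F m n := fun m n => by positivity
  have hFB : ∀ m n, F m n ≤ B n := by
    intro m n
    have hn : (0 : ℝ) < (n : ℝ) + 1 := by positivity
    have h1 := hbound m.1 n
    have h2 := hbound m.2 n
    have h3 : (2 * (n : ℝ) + 1) ^ (2 * -p) ≤ ((n : ℝ) + 1) ^ (2 * -p) :=
      Real.rpow_le_rpow_of_nonpos hn (by linarith [Nat.cast_nonneg (α := ℝ) n]) (by linarith)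
    have h4 : B n = ((n : ℝ) + 1) ^ (2 * -p) * (4 * (K * ((n : ℝ) + 1) ^ ((j : ℝ) - 1 / 2))) := by
      rw [hB]
      beta_reduce
      rw [show (j : ℝ) - 1 / 2 - 2 * p = 2 * -p + ((j : ℝ) - 1 / 2) by ring, Real.rpow_add hn]
      ring
    rw [h4, hF]
    beta_reduce
    rw [hermiteCoeff_sub]
    gcongr
    nlinarith [sq_nonneg (hermiteCoeff (gaussianCutoffPow j m.1) n +
      hermiteCoeff (gaussianCutoffPow j m.2) n)]
  have hBs : Summable B := by
    refine Summable.mul_left _ ?_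
    -- The threshold on p is exactly what puts this exponent below -1.
    have h := (summable_nat_add_iff 1).2 (Real.summable_nat_rpow.2
      (show (j : ℝ) - 1 / 2 - 2 * p < -1 by linarith))
    simpa using h
  have hFs : ∀ m, Summable (F m) := fun m => hBs.of_nonneg_of_le (hF0 m) (hFB m)
  have hlim : ∀ n, Tendsto (fun m => F m n) atTop (𝓝 0) := by
    intro n
    obtain ⟨a, ha⟩ := exists_tendsto_hermiteCoeff_gaussianCutoffPow j n
    have h1 : Tendsto (fun m : ℕ × ℕ => hermiteCoeff (gaussianCutoffPow j m.1) n) atTop (𝓝 a) :=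
      ha.comp (by rw [← prod_atTop_atTop_eq]; exact tendsto_fst)
    have h2 : Tendsto (fun m : ℕ × ℕ => hermiteCoeff (gaussianCutoffPow j m.2) n) atTop (𝓝 a) :=
      ha.comp (by rw [← prod_atTop_atTop_eq]; exact tendsto_snd)
    simpa [hF, hermiteCoeff_sub] using
      ((h1.sub h2).pow 2).const_mul ((2 * (n : ℝ) + 1) ^ (2 * -p))
  have hsum : Tendsto (fun m => ∑' n, F m n) atTop (𝓝 0) := by
    simpa using tendsto_tsum_of_dominated_convergence hBs hlim
      (Eventually.of_forall fun m n => by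
        rw [Real.norm_eq_abs, abs_of_nonneg (hF0 m n)]; exact hFB m n)
  have hnorm : ∀ m : ℕ × ℕ, hermiteNormSq (-p) (gaussianCutoffPow j m.1 - gaussianCutoffPow j m.2) =
      ENNReal.ofReal (∑' n, F m n) := fun m =>
    (ENNReal.ofReal_tsum_of_nonneg (hF0 m) (hFs m)).symm
  simp only [hnorm]
  simpa using ENNReal.tendsto_ofReal hsum

/-! ### Identification of the limit distribution, and conclusion. -/

theorem tendsto_ofFun_gaussianCutoffPow (j : ℕ) (ψ : 𝓢(ℝ, ℝ)) :
    Tendsto (fun k : ℕ => RealTempered.ofFun (gaussianCutoffPow j k)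
      (gaussianCutoffPow j k).hasTemperateGrowth ψ) atTop
      (𝓝 (RealTempered.ofFun (fun x : ℝ => x ^ j) (hasTemperateGrowth_pow j) ψ)) := by
  have hi : Integrable (fun x : ℝ => ψ x * x ^ j) :=
    (SchwartzMap.bilinLeftCLM (ContinuousLinearMap.mul ℝ ℝ) (hasTemperateGrowth_pow j) ψ).integrable
  simp only [RealTempered.ofFun_apply]
  refine tendsto_integral_of_dominated_convergence (fun x => ‖ψ x * x ^ j‖)
    (fun k => (ψ.continuous.mul (gaussianCutoffPow j k).continuous).aestronglyMeasurable)
    hi.norm (fun k => ae_of_all _ fun x => ?_) (ae_of_all _ fun x => ?_)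
  · simp only [gaussianCutoffPow, polynomialGaussian_apply, Polynomial.eval_pow, Polynomial.eval_X]
    rw [← mul_assoc, norm_mul, Real.norm_eq_abs (Real.exp _), Real.abs_exp]
    refine mul_le_of_le_one_right (norm_nonneg _) (Real.exp_le_one_iff.2 ?_)
    rw [neg_mul]
    exact neg_nonpos.2 (by positivity)
  · simp only [gaussianCutoffPow, polynomialGaussian_apply, Polynomial.eval_pow, Polynomial.eval_X]
    have h := (tendsto_one_div_add_atTop_nhds_zero_nat (𝕜 := ℝ)).neg.mul_const (x ^ 2)
    have he := (Real.continuous_exp.tendsto _).comp h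
    simpa using (he.const_mul (x ^ j)).const_mul (ψ x)

/-- The monomial `x ^ j` belongs to `S_{-p}` for every `p > j / 2 + 1 / 4`. -/
theorem ofFun_pow_mem_hermiteSobolev (j : ℕ) {p : ℝ} (hp : (j : ℝ) / 2 + 1 / 4 < p) :
    RealTempered.ofFun (fun x : ℝ => x ^ j) (hasTemperateGrowth_pow j) ∈ HermiteSobolev (-p) :=
  ⟨gaussianCutoffPow j, tendsto_hermiteNormSq_gaussianCutoffPow_sub j hp,
    tendsto_ofFun_gaussianCutoffPow j⟩

theorem mainTheorem11 :
    (∀ p : ℝ, 3 / 4 < p →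
      RealTempered.ofFun (fun x : ℝ => x) hasTemperateGrowth_fun_id ∈ HermiteSobolev (-p)) ∧
    (∀ p : ℝ, 7 / 4 < p →
      RealTempered.ofFun (fun x : ℝ => x ^ 3) (hasTemperateGrowth_pow 3) ∈
        HermiteSobolev (-p)) := by
  refine ⟨fun p hp => ?_, fun p hp => ofFun_pow_mem_hermiteSobolev 3 (by norm_num; linarith)⟩
  have h := ofFun_pow_mem_hermiteSobolev 1 (p := p) (by norm_num; linarith)
  simpa only [pow_one] using h
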